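/- Let $K$ be a field, $S=K[x_1,\dots,x_n]$, and $d\in\mathbf N=\{0,1,2,\dots\}$. Let $J\subseteq I$ be square free monomial ideals of $S$ such that $I$ is generated by square free monomials of degrees $\ge d$ and $J$ is generated by square free monomials of degrees $\ge d+1$. Let $V$ be an ideal generated by $e$ square free monomials of degrees $\ge d+2$, none of which lies in $I$ ($e\ge 0$). For square free monomial ideals $J'\subseteq I'$ of $S$ let $P_{I'\setminus J'}$ be the finite poset of the square free monomials in $I'\setminus J'$, ordered by divisibility, and put $$\operatorname{sdepth}_S I'/J'=\max_{\mathcal P}\ \min_i \deg v_i,$$ where $\mathcal P$ runs over the partitions $P_{I'\setminus J'}=\bigcup_i[u_i,v_i]$ into pairwise disjoint intervals $[u,v]=\{w\in P_{I'\setminus J'}: u\mid w,\ w\mid v\}$ (with $u_i,v_i\in P_{I'\setminus J'}$, $u_i\mid v_i$). Let $\operatorname{depth}_S I'/J'$ be the largest length of an $I'/J'$-regular sequence in $(x_1,\dots,x_n)$. Both invariants are $\infty$ if $I'=J'$. Then: 1. if $\operatorname{sdepth}_S (I+V)/J\le d+1$, then $\operatorname{sdepth}_S I/J\le d+1$; 2.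 $\operatorname{depth}_S (I+V)/J\le d+1$ if and only if $\operatorname{depth}_S I/J\le d+1$. -/

import Mathlib

noncomputable section

namespace SqfIdeal

open MvPolynomial

/-- The squarefree monomial `∏_{i ∈ A} x_i` of `S = K[x_1, …, x_n]`. Every squarefree monomial is
of this form for a unique `A`; its degree is `A.card`, and divisibility is inclusion. -/
def sqfMonomial (K : Type*) [Field K] {n : ℕ} (A : Finset (Fin n)) : MvPolynomial (Fin n) K :=
  ∏ i ∈ A, X i

/-- `I` is a squarefree monomial ideal generated in degrees `≥ d`: it is generated by a
(possibly empty) set of squarefree monomials of degrees `≥ d`. -/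
def IsSqfIdealGE {K : Type*} [Field K] {n : ℕ} (d : ℕ) (I : Ideal (MvPolynomial (Fin n) K)) :
    Prop :=
  ∃ G : Set (Finset (Fin n)), (∀ A ∈ G, d ≤ A.card) ∧ I = Ideal.span (sqfMonomial K '' G)

/-- The poset of squarefree monomials in `I \ J`, ordered by divisibility; a squarefree monomial is
represented by its set of variables, so that divisibility is inclusion. -/
def sqfPoset {K : Type*} [Field K] {n : ℕ} (I J : Ideal (MvPolynomial (Fin n) K)) :
    Set (Finset (Fin n)) :=
  {A | sqfMonomial K A ∈ I ∧ sqfMonomial K A ∉ J}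

/-- The interval `[u, v]` of a poset `P` of squarefree monomials. -/
def interval {n : ℕ} (P : Set (Finset (Fin n))) (u v : Finset (Fin n)) : Set (Finset (Fin n)) :=
  {w ∈ P | u ⊆ w ∧ w ⊆ v}

/-- `D`, a finite set of pairs `(u, v)` of elements `u ∣ v` of `P`, is a partition of `P` into the
intervals `[u, v]`. -/
structure IsIntervalPartition {n : ℕ} (P : Set (Finset (Fin n)))
    (D : Finset (Finset (Fin n) × Finset (Fin n))) : Prop where
  endpoints : ∀ p ∈ D, p.1 ∈ P ∧ p.2 ∈ P ∧ p.1 ⊆ p.2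
  cover : ∀ w ∈ P, ∃ p ∈ D, w ∈ interval P p.1 p.2
  disjoint : ∀ p ∈ D, ∀ q ∈ D, p ≠ q →
    Disjoint (interval P p.1 p.2) (interval P q.1 q.2)

/-- The Stanley depth of `I/J`: the maximum over all interval partitions of the poset of squarefree
monomials of `I \ J` of the least degree of an upper end of an interval. It is `∞` exactly when
that poset is empty. -/
def sdepth {K : Type*} [Field K] {n : ℕ} (I J : Ideal (MvPolynomial (Fin n) K)) : ℕ∞ :=
  ⨆ (D : Finset (Finset (Fin n) × Finset (Fin n)))
    (_ : IsIntervalPartition (sqfPoset I J) D), ⨅ p ∈ D, (p.2.card : ℕ∞)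

open Classical in
/-- The depth (grade) of an `R`-module `M` with respect to an ideal `𝔪`: the supremum of the
lengths of `M`-regular sequences of elements of `𝔪`, and `∞` if `𝔪 M = M`. -/
def depthAt {R : Type*} [CommRing R] (𝔪 : Ideal R) (M : Type*) [AddCommGroup M] [Module R M] :
    ℕ∞ :=
  if 𝔪 • (⊤ : Submodule R M) = ⊤ then ⊤
  else ⨆ (rs : List R) (_ : (∀ r ∈ rs, r ∈ 𝔪) ∧ RingTheory.Sequence.IsRegular M rs),
    (rs.length : ℕ∞)

/-- The depth of the `S`-module `I/J`, for ideals `J ⊆ I` of `S = K[x_1, …, x_n]`, with respect to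
the graded maximal ideal `(x_1, …, x_n)`. -/
def depth {K : Type*} [Field K] {n : ℕ} (I J : Ideal (MvPolynomial (Fin n) K)) : ℕ∞ :=
  depthAt (Ideal.span (Set.range (X : Fin n → MvPolynomial (Fin n) K)))
    (↥I ⧸ Submodule.submoduleOf J I)

end SqfIdeal

end

/-!
Every squarefree monomial of `(I + V) \ I` is divisible by a generator of `V`, hence has degree at
least `d + 2`. Both claims rest on this.

For the Stanley depth, an interval partition of `I \ J` becomes one of `(I + V) \ J` by adding the
intervals `[w, w]` for the squarefree monomials `w` of `(I + V) \ I`. If all upper ends had degree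
`≥ d + 2` before, they still do (`lt_sdepth_of_lt_sdepth`).

For the depth, let `𝔪 = (x_1, …, x_n)`. By the Rees theorem the depth of a finitely generated module
`M` exceeds `t` exactly when `Ext^i(S / 𝔪, M) = 0` for all `i ≤ t` (`lt_depthAt_iff`). In the exact
sequence `0 → I / J → (I + V) / J → (I + V) / I → 0` these groups vanish for the third term and all
`i ≤ d + 1`, so the long exact sequence shows that they vanish for `I / J` in this range if and only
if they do for `(I + V) / J` (`ExtVanishing.left`, `ExtVanishing.middle`).

The vanishing for the third term is the fact that a subquotient by squarefree monomial ideals has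
depth at least the least degree of a squarefree monomial in it (`extVanishing_of_forall_sqfPoset`).
Such a subquotient is filtered by modules `S / (x_i : i ∉ w)`, one for each of its squarefree
monomials `w`, and the variables in `w` form a regular sequence on `S / (x_i : i ∉ w)`.
-/

namespace SqfIdeal

open MvPolynomial CategoryTheory Abelian

universe u

/-! ### Vanishing of Ext and depth -/

section ExtVanishing

variable {R : Type u} [CommRing R]

/-- `Ext^i(R ⧸ 𝔪, M) = 0` for all `i < t`; for finitely generated `M` over a noetherian ring this
says that the depth of `M` with respect to `𝔪` is at least `t`. -/
def ExtVanishing (𝔪 : Ideal R) (t : ℕ) (M : Type u) [AddCommGroup M] [Module R M] : Prop :=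
  ∀ i < t, Subsingleton (Ext (ModuleCat.of R (R ⧸ 𝔪)) (ModuleCat.of R M) i)

variable {𝔪 : Ideal R} {t : ℕ} {A B C : Type u} [AddCommGroup A] [Module R A]
  [AddCommGroup B] [Module R B] [AddCommGroup C] [Module R C]

lemma shortExact_of_linearMap (f : A →ₗ[R] B) (g : B →ₗ[R] C) (hf : Function.Injective f)
    (hfg : Function.Exact f g) (hg : Function.Surjective g) :
    (ModuleCat.shortComplexOfCompEqZero f g hfg.linearMap_comp_eq_zero).ShortExact :=
  ModuleCat.shortComplex_shortExact _ hfg hf hg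

lemma ExtVanishing.of_subsingleton [Subsingleton A] : ExtVanishing 𝔪 t A := by
  intro i _
  refine subsingleton_of_forall_eq 0 fun x => ?_
  have h : 𝟙 (ModuleCat.of R A) = 0 := by
    ext a
    exact Subsingleton.elim (α := A) _ _
  rw [← x.comp_mk₀_id, h, Ext.mk₀_zero, Ext.comp_zero]

lemma ExtVanishing.middle {f : A →ₗ[R] B} {g : B →ₗ[R] C} (hf : Function.Injective f)
    (hfg : Function.Exact f g) (hg : Function.Surjective g) (hA : ExtVanishing 𝔪 t A)
    (hC : ExtVanishing 𝔪 t C) : ExtVanishing 𝔪 t B := by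
  intro i hi
  have hS := shortExact_of_linearMap f g hf hfg hg
  refine subsingleton_of_forall_eq 0 fun x => ?_
  obtain ⟨y, rfl⟩ := Ext.covariant_sequence_exact₂ _ hS x ((hC i hi).elim _ _)
  have hy : y = 0 := (hA i hi).elim _ _
  rw [hy, Ext.zero_comp]

lemma ExtVanishing.left {f : A →ₗ[R] B} {g : B →ₗ[R] C} (hf : Function.Injective f)
    (hfg : Function.Exact f g) (hg : Function.Surjective g) (hB : ExtVanishing 𝔪 t B)
    (hC : ExtVanishing 𝔪 t C) : ExtVanishing 𝔪 t A := by
  intro i hi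
  have hS := shortExact_of_linearMap f g hf hfg hg
  refine subsingleton_of_forall_eq 0 fun x => ?_
  have hx : x.comp (Ext.mk₀ (ModuleCat.shortComplexOfCompEqZero f g
      hfg.linearMap_comp_eq_zero).f) (add_zero i) = 0 := (hB i hi).elim _ _
  obtain _ | i := i
  · exact Ext.postcomp_mk₀_injective_of_mono _ _ (hf := hS.mono_f) (by simpa using hx)
  · obtain ⟨y, rfl⟩ := Ext.covariant_sequence_exact₁ _ hS x hx rfl
    have hy : y = 0 := (hC i (by omega)).elim _ _
    rw [hy, Ext.zero_comp]

lemma ExtVanishing.of_linearEquiv (e : A ≃ₗ[R] B) (hB : ExtVanishing 𝔪 t B) :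
    ExtVanishing 𝔪 t A :=
  ExtVanishing.left (C := PUnit.{u + 1}) (f := e.toLinearMap) (g := 0) e.injective
    (fun b => by simp) (fun _ => ⟨0, rfl⟩) hB .of_subsingleton

lemma smul_ext_eq_zero {M : Type u} [AddCommGroup M] [Module R M] {r : R} (hr : r ∈ 𝔪) {i : ℕ}
    (x : Ext (ModuleCat.of R (R ⧸ 𝔪)) (ModuleCat.of R M) i) : r • x = 0 := by
  have h : r • 𝟙 (ModuleCat.of R (R ⧸ 𝔪)) = 0 := by
    ext
    change r • (Ideal.Quotient.mk 𝔪 1) = 0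
    rw [Algebra.smul_def, Ideal.Quotient.algebraMap_eq, ← map_mul, mul_one]
    exact Ideal.Quotient.eq_zero_iff_mem.mpr hr
  rw [← x.mk₀_id_comp, ← Ext.smul_comp, ← Ext.mk₀_smul, h, Ext.mk₀_zero, Ext.zero_comp]

/-- An element `r` of `𝔪` acts as zero on `Ext^i(R ⧸ 𝔪, B)`, so when it is `B`-regular the long exact
sequence makes `Ext^(i+1)(R ⧸ 𝔪, B)` a quotient of `Ext^i(R ⧸ 𝔪, B / rB)`. Here `g` presents `C` as
`B / rB`. -/
lemma ExtVanishing.of_regular {r : R} (hr : r ∈ 𝔪) {g : B →ₗ[R] C}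
    (hf : Function.Injective (LinearMap.lsmul R B r))
    (hfg : Function.Exact (LinearMap.lsmul R B r) g) (hg : Function.Surjective g)
    (hC : ExtVanishing 𝔪 t C) : ExtVanishing 𝔪 (t + 1) B := by
  intro i hi
  have hS := shortExact_of_linearMap _ g hf hfg hg
  refine subsingleton_of_forall_eq 0 fun x => ?_
  have hx : x.comp (Ext.mk₀ (ModuleCat.shortComplexOfCompEqZero _ g
      hfg.linearMap_comp_eq_zero).f) (add_zero i) = 0 :=
    (Ext.smul_eq_comp_mk₀ x r).symm.trans (smul_ext_eq_zero hr x)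
  obtain _ | i := i
  · exact Ext.postcomp_mk₀_injective_of_mono _ _ (hf := hS.mono_f) (by simpa using hx)
  · obtain ⟨y, rfl⟩ := Ext.covariant_sequence_exact₁ _ hS x hx rfl
    have hy : y = 0 := (hC i (by omega)).elim _ _
    rw [hy, Ext.zero_comp]

lemma ExtVanishing.of_smul_top_eq_top [Module.Finite R A]
    (h : 𝔪 • (⊤ : Submodule R A) = ⊤) : ExtVanishing 𝔪 t A := by
  intro i _
  obtain ⟨r, hr, hrA⟩ := Submodule.exists_sub_one_mem_and_smul_eq_zero_of_fg_of_le_smul 𝔪 ⊤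
    (Module.Finite.fg_top (R := R) (M := A)) h.ge
  have h0 : r • 𝟙 (ModuleCat.of R A) = 0 := by
    ext a
    exact hrA a trivial
  refine subsingleton_of_forall_eq 0 fun x => ?_
  have h1 : r • x = 0 := by rw [Ext.smul_eq_comp_mk₀, h0, Ext.mk₀_zero, Ext.comp_zero]
  simpa [sub_smul, h1] using smul_ext_eq_zero hr x

/-- The Rees theorem in terms of `depthAt`. When `𝔪 A = A` both sides hold: the depth is `∞`, and
by Nakayama `A` is annihilated by an element of `1 + 𝔪`. -/
lemma lt_depthAt_iff [IsNoetherianRing R] [Module.Finite R A] :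
    (t : ℕ∞) < depthAt 𝔪 A ↔ ExtVanishing 𝔪 (t + 1) A := by
  unfold depthAt
  split_ifs with h
  · exact ⟨fun _ => .of_smul_top_eq_top h, fun _ => ENat.natCast_lt_top t⟩
  · have hsupp : Module.support R (R ⧸ 𝔪) = PrimeSpectrum.zeroLocus 𝔪 := by
      rw [Module.support_eq_zeroLocus, Ideal.annihilator_quotient]
    have : Module.Finite R (ModuleCat.of R A) := ‹Module.Finite R A›
    have : Module.Finite R (ModuleCat.of R (R ⧸ 𝔪)) :=
      inferInstanceAs (Module.Finite R (R ⧸ 𝔪))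
    simp only [lt_iSup_iff]
    constructor
    · rintro ⟨rs, ⟨hmem, hreg⟩, hlt⟩ i hi
      exact ModuleCat.subsingleton_ext_of_exists_isRegular 𝔪 (ModuleCat.of R (R ⧸ 𝔪)) hsupp.subset
        (ModuleCat.of R A) (lt_top_iff_ne_top.mpr h) rs hmem hreg i
        (hi.trans_le (by exact_mod_cast hlt))
    · intro hext
      obtain ⟨rs, hlen, hmem, hreg⟩ := ModuleCat.exists_isRegular_of_exists_subsingleton_ext 𝔪
        (t + 1) (ModuleCat.of R A) (lt_top_iff_ne_top.mpr h) (ModuleCat.of R (R ⧸ 𝔪)) hsupp hext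
      exact ⟨rs, ⟨hmem, hreg⟩, by rw [hlen]; exact_mod_cast t.lt_succ_self⟩

end ExtVanishing

/-! ### Subquotients of a module -/

section SubmoduleQuotients

variable {R : Type u} [CommRing R] {M : Type u} [AddCommGroup M] [Module R M]
  {L N P : Submodule R M}

/-- The third isomorphism theorem `0 → N / L → P / L → P / N → 0`, in the encoding of subquotients
by `Submodule.submoduleOf`. -/
lemma exists_exact_subquotients (hLN : L ≤ N) (hNP : N ≤ P) :
    ∃ (f : (N ⧸ L.submoduleOf N) →ₗ[R] (P ⧸ L.submoduleOf P))
      (g : (P ⧸ L.submoduleOf P) →ₗ[R] (P ⧸ N.submoduleOf P)),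
      Function.Injective f ∧ Function.Exact f g ∧ Function.Surjective g := by
  refine ⟨Submodule.mapQ _ _ (Submodule.inclusion hNP) (fun x hx => hx),
    Submodule.factor (Submodule.comap_mono hLN), ?_, ?_, Submodule.factor_surjective _⟩
  · rw [← LinearMap.ker_eq_bot, LinearMap.ker_eq_bot']
    intro x hx
    obtain ⟨x, rfl⟩ := Submodule.Quotient.mk_surjective _ x
    have hx' : Submodule.inclusion hNP x ∈ L.submoduleOf P :=
      (Submodule.Quotient.mk_eq_zero _).mp hx
    exact (Submodule.Quotient.mk_eq_zero _).mpr hx'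
  · intro y
    obtain ⟨y, rfl⟩ := Submodule.Quotient.mk_surjective _ y
    constructor
    · intro hy
      have hy' : y ∈ N.submoduleOf P := (Submodule.Quotient.mk_eq_zero _).mp hy
      exact ⟨Submodule.Quotient.mk ⟨y, hy'⟩, rfl⟩
    · rintro ⟨x, hx⟩
      obtain ⟨x, rfl⟩ := Submodule.Quotient.mk_surjective _ x
      rw [← hx]
      exact (Submodule.Quotient.mk_eq_zero _).mpr x.2

end SubmoduleQuotients

/-! ### Squarefree monomial ideals -/

section SquarefreeIdeals

variable {K : Type u} [Field K] {n : ℕ}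

lemma sqfMonomial_eq_monomial (A : Finset (Fin n)) :
    sqfMonomial K A = monomial (∑ i ∈ A, Finsupp.single i 1) 1 := by
  rw [monomial_sum_one]
  rfl

lemma sum_single_apply (A : Finset (Fin n)) (j : Fin n) :
    (∑ i ∈ A, Finsupp.single i 1 : Fin n →₀ ℕ) j = if j ∈ A then 1 else 0 := by
  simp [Finsupp.finsetSum_apply, Finsupp.single_apply]

lemma sum_single_le_iff (A : Finset (Fin n)) (m : Fin n →₀ ℕ) :
    ∑ i ∈ A, Finsupp.single i 1 ≤ m ↔ A ⊆ m.support := by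
  simp only [Finsupp.le_def, sum_single_apply, Finset.subset_iff, Finsupp.mem_support_iff]
  refine forall_congr' fun j => ?_
  split_ifs with h <;> simp [h, Nat.one_le_iff_ne_zero]

lemma support_sum_single (A : Finset (Fin n)) :
    (∑ i ∈ A, Finsupp.single i 1 : Fin n →₀ ℕ).support = A := by
  ext j
  simp [Finsupp.mem_support_iff, sum_single_apply]

lemma mem_span_sqfMonomial_iff {G : Set (Finset (Fin n))} {p : MvPolynomial (Fin n) K} :
    p ∈ Ideal.span (sqfMonomial K '' G) ↔ ∀ m ∈ p.support, ∃ A ∈ G, A ⊆ m.support := by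
  have h : sqfMonomial K '' G =
      (fun m => monomial m 1) '' ((fun A => ∑ i ∈ A, Finsupp.single i 1) '' G) := by
    rw [Set.image_image]
    exact Set.image_congr fun A _ => sqfMonomial_eq_monomial A
  rw [h, mem_ideal_span_monomial_image]
  simp [sum_single_le_iff]

lemma sqfMonomial_mem_span_iff {G : Set (Finset (Fin n))} {A : Finset (Fin n)} :
    sqfMonomial K A ∈ Ideal.span (sqfMonomial K '' G) ↔ ∃ B ∈ G, B ⊆ A := by
  rw [mem_span_sqfMonomial_iff, sqfMonomial_eq_monomial]
  simp [support_sum_single]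

lemma sqfMonomial_mem_of_subset {I : Ideal (MvPolynomial (Fin n) K)} {A B : Finset (Fin n)}
    (hAB : A ⊆ B) (hA : sqfMonomial K A ∈ I) : sqfMonomial K B ∈ I :=
  I.mem_of_dvd (Finset.prod_dvd_prod_of_subset _ _ _ hAB) hA

/-- Multiplying by `∏_{i ∈ A} x_i` replaces the support `supp m` of each monomial by
`supp m ∪ A`. -/
lemma mul_sqfMonomial_mem_span_iff {G : Set (Finset (Fin n))} {p : MvPolynomial (Fin n) K}
    {A : Finset (Fin n)} : p * sqfMonomial K A ∈ Ideal.span (sqfMonomial K '' G) ↔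
      ∀ m ∈ p.support, ∃ B ∈ G, B ⊆ m.support ∪ A := by
  rw [mem_span_sqfMonomial_iff, sqfMonomial_eq_monomial]
  have h (m : Fin n →₀ ℕ) : (m + ∑ i ∈ A, Finsupp.single i 1).support = m.support ∪ A := by
    ext j
    simp only [Finsupp.mem_support_iff, Finsupp.add_apply, sum_single_apply, Finset.mem_union]
    split_ifs with hj <;> simp [hj]
  constructor
  · intro H m hm
    rw [← h]
    refine H _ ?_
    rw [mem_support_iff, coeff_mul_monomial, mul_one]
    exact mem_support_iff.mp hm
  · intro H m hm
    rw [mem_support_iff, coeff_mul_monomial'] at hm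
    split_ifs at hm with hle
    · obtain ⟨B, hB, hBA⟩ := H _ (mem_support_iff.mpr (left_ne_zero_of_mul hm))
      refine ⟨B, hB, ?_⟩
      rwa [← h, tsub_add_cancel_of_le hle] at hBA
    · exact absurd rfl hm

variable (K n) in
/-- The ideal `(x_1, …, x_n)`. -/
noncomputable abbrev irrelevantIdeal : Ideal (MvPolynomial (Fin n) K) :=
  Ideal.span (Set.range (X : Fin n → MvPolynomial (Fin n) K))

lemma X_mul_mem_span_X_iff {s : Set (Fin n)} {j : Fin n} (hj : j ∉ s)
    {p : MvPolynomial (Fin n) K} :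
    X j * p ∈ Ideal.span (X '' s : Set (MvPolynomial (Fin n) K)) ↔
      p ∈ Ideal.span (X '' s : Set (MvPolynomial (Fin n) K)) := by
  refine ⟨fun h => ?_, Ideal.mul_mem_left _ _⟩
  rw [mem_ideal_span_X_image] at h ⊢
  intro m hm
  obtain ⟨i, hi, hne⟩ := h (m + Finsupp.single j 1) (by
    rw [mem_support_iff, add_comm, coeff_X_mul]
    exact mem_support_iff.mp hm)
  have hij : j ≠ i := fun h => hj (h ▸ hi)
  exact ⟨i, hi, by simpa [Finsupp.single_apply, hij] using hne⟩

/-- The quotient of `S` by the variables outside `A` is a polynomial ring in `A.card` variables;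
the variables in `A` form a regular sequence on it. -/
lemma extVanishing_quotient_span_X (A : Finset (Fin n)) :
    ExtVanishing (irrelevantIdeal K n) A.card
      (MvPolynomial (Fin n) K ⧸
        Ideal.span (X '' (A : Set (Fin n))ᶜ : Set (MvPolynomial (Fin n) K))) := by
  induction A using Finset.induction_on with
  | empty => exact fun i hi => absurd hi (Nat.not_lt_zero i)
  | insert j A hj ih =>
    rw [Finset.card_insert_of_notMem hj]
    have hsub : ((insert j A : Finset (Fin n)) : Set (Fin n))ᶜ ⊆ (A : Set (Fin n))ᶜ := by
      simp
    have hjmem : j ∉ ((insert j A : Finset (Fin n)) : Set (Fin n))ᶜ := by simp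
    have hcompl : (A : Set (Fin n))ᶜ = insert j ((insert j A : Finset (Fin n)) : Set (Fin n))ᶜ := by
      ext i
      by_cases hij : i = j <;> simp [hij, hj]
    refine ExtVanishing.of_regular (r := X j) (Ideal.subset_span ⟨j, rfl⟩)
      (g := Submodule.factor (Ideal.span_mono (Set.image_mono hsub))) ?_ ?_
      (Submodule.factor_surjective _) ih
    · rw [← LinearMap.ker_eq_bot, LinearMap.ker_eq_bot']
      intro p hp
      obtain ⟨p, rfl⟩ := Submodule.Quotient.mk_surjective _ p
      rw [LinearMap.lsmul_apply, ← Submodule.Quotient.mk_smul, Submodule.Quotient.mk_eq_zero,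
        smul_eq_mul, X_mul_mem_span_X_iff hjmem] at hp
      exact (Submodule.Quotient.mk_eq_zero _).mpr hp
    · intro p
      obtain ⟨p, rfl⟩ := Submodule.Quotient.mk_surjective _ p
      constructor
      · intro hp
        have hp' : p ∈ Ideal.span (X '' (A : Set (Fin n))ᶜ) :=
          (Submodule.Quotient.mk_eq_zero _).mp hp
        rw [hcompl, Set.image_insert_eq, Ideal.mem_span_insert] at hp'
        obtain ⟨a, z, hz, rfl⟩ := hp'
        refine ⟨Submodule.Quotient.mk a, ?_⟩
        rw [LinearMap.lsmul_apply, ← Submodule.Quotient.mk_smul, Submodule.Quotient.eq]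
        simpa [mul_comm, sub_add_eq_sub_sub] using hz
      · rintro ⟨q, hq⟩
        obtain ⟨q, rfl⟩ := Submodule.Quotient.mk_surjective _ q
        rw [← hq]
        refine (Submodule.Quotient.mk_eq_zero _).mpr ?_
        exact Ideal.mul_mem_right _ _ (Ideal.subset_span ⟨j, by simpa using hj, rfl⟩)

/-- If `w` is a monomial outside `J` such that `x_i w ∈ J` for all `i ∉ supp w`, then
`J : w` is generated by the variables not in `w`, so `(J + (w)) / J ≅ S / (J : w)` is a polynomial
ring in the variables of `w`. -/
lemma extVanishing_of_maximal {G : Set (Finset (Fin n))} {w : Finset (Fin n)}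
    (hw : ∀ B ∈ G, ¬ B ⊆ w) (hmax : ∀ i ∉ w, ∃ B ∈ G, B ⊆ insert i w) :
    ExtVanishing (irrelevantIdeal K n) w.card
      (↥(Ideal.span (sqfMonomial K '' insert w G)) ⧸
        Submodule.submoduleOf (Ideal.span (sqfMonomial K '' G))
          (Ideal.span (sqfMonomial K '' insert w G))) := by
  set J := Ideal.span (sqfMonomial K '' G) with hJ
  set J' := Ideal.span (sqfMonomial K '' insert w G) with hJ'
  have hwJ' : sqfMonomial K w ∈ J' := Ideal.subset_span ⟨w, Set.mem_insert _ _, rfl⟩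
  let φ : MvPolynomial (Fin n) K →ₗ[MvPolynomial (Fin n) K] (↥J' ⧸ Submodule.submoduleOf J J') :=
    (Submodule.mkQ _).comp (LinearMap.toSpanSingleton _ _ (⟨sqfMonomial K w, hwJ'⟩ : J'))
  have hker : LinearMap.ker φ = Ideal.span (X '' (w : Set (Fin n))ᶜ) := by
    ext p
    have h1 : p ∈ LinearMap.ker φ ↔ p * sqfMonomial K w ∈ J := Submodule.Quotient.mk_eq_zero _
    rw [h1, hJ, mul_sqfMonomial_mem_span_iff, mem_ideal_span_X_image]
    refine forall₂_congr fun m _ => ⟨?_, ?_⟩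
    · rintro ⟨B, hB, hBm⟩
      by_contra! H
      refine hw B hB fun i hi => ?_
      by_contra hiw
      rcases Finset.mem_union.mp (hBm hi) with h | h
      · exact Finsupp.mem_support_iff.mp h (H i (by simpa using hiw))
      · exact hiw h
    · rintro ⟨i, hi, hmi⟩
      obtain ⟨B, hB, hBi⟩ := hmax i (by simpa using hi)
      refine ⟨B, hB, hBi.trans (Finset.insert_subset ?_ Finset.subset_union_right)⟩
      exact Finset.mem_union_left _ (Finsupp.mem_support_iff.mpr hmi)
  have hsurj : Function.Surjective φ := by
    intro y
    obtain ⟨⟨y, hy⟩, rfl⟩ := Submodule.Quotient.mk_surjective _ y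
    have hy' := hy
    rw [hJ', Set.image_insert_eq, Ideal.mem_span_insert] at hy'
    obtain ⟨a, z, hz, rfl⟩ := hy'
    refine ⟨a, (Submodule.Quotient.eq _).mpr ?_⟩
    change a * sqfMonomial K w - (a * sqfMonomial K w + z) ∈ J
    simpa using hz
  exact .of_linearEquiv (φ.quotKerEquivOfSurjective hsurj).symm
    (.of_linearEquiv (Submodule.quotEquivOfEq _ _ hker) (extVanishing_quotient_span_X w))

/-- The depth of a squarefree subquotient `I / J` is at least the least degree of a squarefree
monomial in `I \ J`: adjoining to `J` the monomials of `I \ J` one at a time, from the top of the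
divisibility order down, filters `I / J` with polynomial rings in the variables of these monomials
as factors. -/
lemma extVanishing_of_forall_sqfPoset {t : ℕ} {GI GJ : Set (Finset (Fin n))}
    (hJI : Ideal.span (sqfMonomial K '' GJ) ≤ Ideal.span (sqfMonomial K '' GI))
    (ht : ∀ A ∈ sqfPoset (Ideal.span (sqfMonomial K '' GI)) (Ideal.span (sqfMonomial K '' GJ)),
      t ≤ A.card) :
    ExtVanishing (irrelevantIdeal K n) t
      (↥(Ideal.span (sqfMonomial K '' GI)) ⧸
        Submodule.submoduleOf (Ideal.span (sqfMonomial K '' GJ))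
          (Ideal.span (sqfMonomial K '' GI))) := by
  induction h : (sqfPoset (Ideal.span (sqfMonomial K '' GI))
    (Ideal.span (sqfMonomial K '' GJ))).ncard using Nat.strong_induction_on generalizing GJ with
  | _ N ih =>
  set I := Ideal.span (sqfMonomial K '' GI) with hI
  set J := Ideal.span (sqfMonomial K '' GJ) with hJ
  obtain hemp | hne := (sqfPoset I J).eq_empty_or_nonempty
  · have hIJ : I ≤ J := by
      rw [hI, Ideal.span_le]
      rintro _ ⟨A, hA, rfl⟩
      by_contra hAJ
      exact Set.eq_empty_iff_forall_notMem.mp hemp A ⟨Ideal.subset_span ⟨A, hA, rfl⟩, hAJ⟩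
    have : Subsingleton (↥I ⧸ Submodule.submoduleOf J I) :=
      Submodule.Quotient.subsingleton_iff.mpr (Submodule.submoduleOf_eq_top.mpr hIJ)
    exact .of_subsingleton
  · obtain ⟨w, hw⟩ := (Set.toFinite (sqfPoset I J)).exists_maximal hne
    have hwJ : ∀ B ∈ GJ, ¬ B ⊆ w := fun B hB hBw =>
      hw.prop.2 (sqfMonomial_mem_span_iff.mpr ⟨B, hB, hBw⟩)
    have hmax : ∀ i ∉ w, ∃ B ∈ GJ, B ⊆ insert i w := by
      intro i hi
      by_contra hB
      rw [← sqfMonomial_mem_span_iff (K := K)] at hB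
      exact hi (hw.le_of_ge ⟨sqfMonomial_mem_of_subset (Finset.subset_insert i w) hw.prop.1, hB⟩
        (Finset.subset_insert i w) (Finset.mem_insert_self i w))
    have hJJ' : J ≤ Ideal.span (sqfMonomial K '' insert w GJ) :=
      Ideal.span_mono (Set.image_mono (Set.subset_insert _ _))
    have hJ'I : Ideal.span (sqfMonomial K '' insert w GJ) ≤ I := by
      rw [Set.image_insert_eq, Ideal.span_le, Set.insert_subset_iff]
      exact ⟨hw.prop.1, Ideal.span_le.mp hJI⟩
    have hsub : sqfPoset I (Ideal.span (sqfMonomial K '' insert w GJ)) ⊂ sqfPoset I J := by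
      refine ⟨fun A hA => ⟨hA.1, fun hAJ => hA.2 (hJJ' hAJ)⟩, fun hle => ?_⟩
      exact (hle hw.prop).2 (Ideal.subset_span ⟨w, Set.mem_insert _ _, rfl⟩)
    obtain ⟨f, g, hf, hfg, hg⟩ := exists_exact_subquotients hJJ' hJ'I
    refine ExtVanishing.middle hf hfg hg ?_ ?_
    · exact fun i hi => extVanishing_of_maximal hwJ hmax i (hi.trans_le (ht w hw.prop))
    · exact ih _ (h ▸ Set.ncard_lt_ncard hsub) hJ'I (fun A hA => ht A (hsub.1 hA)) rfl

end SquarefreeIdeals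

/-! ### Stanley depth -/

section StanleyDepth

variable {K : Type u} [Field K] {n : ℕ}

/-- An interval partition for `I \ J` extends to one for `I' \ J` by adding the singletons
`[w, w]` for `w` in `I' \ I`; this does not lower the minimum below `t + 1`. -/
lemma lt_sdepth_of_lt_sdepth {I I' J : Ideal (MvPolynomial (Fin n) K)} (hJI : J ≤ I) (hII' : I ≤ I')
    {t : ℕ} (ht : ∀ A ∈ sqfPoset I' I, t + 1 ≤ A.card) (h : (t : ℕ∞) < sdepth I J) :
    (t : ℕ∞) < sdepth I' J := by
  simp only [sdepth, lt_iSup_iff] at h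
  obtain ⟨D, hD, hlt⟩ := h
  let E : Finset (Finset (Fin n) × Finset (Fin n)) :=
    (Set.toFinite (sqfPoset I' I)).toFinset.image fun w => (w, w)
  have hE : ∀ p, p ∈ E ↔ p.1 ∈ sqfPoset I' I ∧ p.2 = p.1 := by
    rintro ⟨a, b⟩
    simp only [E, Finset.mem_image, Set.Finite.mem_toFinset, Prod.mk.injEq]
    constructor
    · rintro ⟨w, hw, rfl, rfl⟩
      exact ⟨hw, rfl⟩
    · rintro ⟨ha, rfl⟩
      exact ⟨_, ha, rfl, rfl⟩
  have hmono : ∀ {A}, A ∈ sqfPoset I J → A ∈ sqfPoset I' J := fun hA => ⟨hII' hA.1, hA.2⟩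
  have hmono' : ∀ {A}, A ∈ sqfPoset I' I → A ∈ sqfPoset I' J :=
    fun hA => ⟨hA.1, fun hAJ => hA.2 (hJI hAJ)⟩
  have hintD : ∀ p ∈ D, interval (sqfPoset I' J) p.1 p.2 = interval (sqfPoset I J) p.1 p.2 := by
    intro p hp
    ext A
    exact ⟨fun hA => ⟨⟨sqfMonomial_mem_of_subset hA.2.1 (hD.endpoints p hp).1.1, hA.1.2⟩, hA.2⟩,
      fun hA => ⟨hmono hA.1, hA.2⟩⟩
  have hintE : ∀ p ∈ E, ∀ A ∈ interval (sqfPoset I' J) p.1 p.2, A = p.1 := by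
    intro p hp A hA
    exact (hA.2.2.trans ((hE p).mp hp).2.le).antisymm hA.2.1
  have hDE : ∀ p ∈ D, ∀ q ∈ E,
      Disjoint (interval (sqfPoset I' J) p.1 p.2) (interval (sqfPoset I' J) q.1 q.2) := by
    intro p hp q hq
    refine Set.disjoint_left.mpr fun A hAp hAq => ?_
    rw [hintD p hp] at hAp
    rw [hintE q hq A hAq] at hAp
    exact ((hE q).mp hq).1.2 hAp.1.1
  have hpart : IsIntervalPartition (sqfPoset I' J) (D ∪ E) := by
    refine ⟨fun p hp => ?_, fun A hA => ?_, fun p hp q hq hpq => ?_⟩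
    · rcases Finset.mem_union.mp hp with hp | hp
      · have := hD.endpoints p hp
        exact ⟨hmono this.1, hmono this.2.1, this.2.2⟩
      · obtain ⟨h1, h2⟩ := (hE p).mp hp
        exact ⟨hmono' h1, h2 ▸ hmono' h1, h2.ge⟩
    · by_cases hAI : sqfMonomial K A ∈ I
      · obtain ⟨p, hp, hAp⟩ := hD.cover A ⟨hAI, hA.2⟩
        exact ⟨p, Finset.mem_union_left _ hp, (hintD p hp).symm ▸ hAp⟩
      · exact ⟨(A, A), Finset.mem_union_right _ ((hE _).mpr ⟨⟨hA.1, hAI⟩, rfl⟩),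
          hA, subset_rfl, subset_rfl⟩
    · rcases Finset.mem_union.mp hp with hp | hp <;> rcases Finset.mem_union.mp hq with hq | hq
      · rw [hintD p hp, hintD q hq]
        exact hD.disjoint p hp q hq hpq
      · exact hDE p hp q hq
      · exact (hDE q hq p hp).symm
      · refine Set.disjoint_left.mpr fun A hAp hAq => hpq ?_
        have h1 := (hintE p hp A hAp).symm.trans (hintE q hq A hAq)
        exact Prod.ext h1 (((hE p).mp hp).2.trans (h1.trans ((hE q).mp hq).2.symm))
  have hle : ((t + 1 : ℕ) : ℕ∞) ≤ ⨅ p ∈ D ∪ E, (p.2.card : ℕ∞) := by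
    refine le_iInf₂ fun p hp => ?_
    rcases Finset.mem_union.mp hp with hp | hp
    · have := hlt.trans_le (iInf₂_le p hp)
      exact_mod_cast this
    · obtain ⟨h1, h2⟩ := (hE p).mp hp
      rw [h2]
      exact_mod_cast ht _ h1
  exact (by exact_mod_cast t.lt_succ_self : (t : ℕ∞) < ((t + 1 : ℕ) : ℕ∞)).trans_le
    (hle.trans (le_iSup₂_of_le (D ∪ E) hpart le_rfl))

end StanleyDepth

end SqfIdeal

theorem lemma1p6 {K : Type*} [Field K] {n : ℕ} (d e : ℕ)
    (I J V : Ideal (MvPolynomial (Fin n) K))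
    (hI : SqfIdeal.IsSqfIdealGE d I) (hJ : SqfIdeal.IsSqfIdealGE (d + 1) J) (hJI : J ≤ I)
    (v : Fin e → Finset (Fin n))
    (hvdeg : ∀ i, d + 2 ≤ (v i).card)
    (hvI : ∀ i, SqfIdeal.sqfMonomial K (v i) ∉ I)
    (hV : V = Ideal.span (Set.range fun i => SqfIdeal.sqfMonomial K (v i))) :
    (SqfIdeal.sdepth (I + V) J ≤ ((d + 1 : ℕ) : ℕ∞) →
      SqfIdeal.sdepth I J ≤ ((d + 1 : ℕ) : ℕ∞)) ∧
    (SqfIdeal.depth (I + V) J ≤ ((d + 1 : ℕ) : ℕ∞) ↔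
      SqfIdeal.depth I J ≤ ((d + 1 : ℕ) : ℕ∞)) := by
  obtain ⟨G, -, hG⟩ := hI
  have hsum : I + V = Ideal.span (SqfIdeal.sqfMonomial K '' (G ∪ Set.range v)) := by
    rw [Set.image_union, Ideal.span_union, ← Set.range_comp, ← hG, Submodule.add_eq_sup, hV]
    rfl
  have hle : I ≤ I + V := le_sup_left
  have hdeg : ∀ A ∈ SqfIdeal.sqfPoset (I + V) I, d + 1 + 1 ≤ A.card := by
    rintro A ⟨hA, hAI⟩
    rw [hsum, SqfIdeal.sqfMonomial_mem_span_iff] at hA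
    obtain ⟨B, hB | ⟨i, rfl⟩, hBA⟩ := hA
    · exact absurd (hG ▸ SqfIdeal.sqfMonomial_mem_span_iff.mpr ⟨B, hB, hBA⟩) hAI
    · exact (hvdeg i).trans (Finset.card_le_card hBA)
  constructor
  · contrapose!
    exact SqfIdeal.lt_sdepth_of_lt_sdepth hJI hle hdeg
  · have hC : SqfIdeal.ExtVanishing (SqfIdeal.irrelevantIdeal K n) (d + 1 + 1)
        (↥(I + V) ⧸ Submodule.submoduleOf I (I + V)) := by
      rw [hsum, hG] at hdeg hle ⊢
      exact SqfIdeal.extVanishing_of_forall_sqfPoset hle hdeg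
    obtain ⟨f, g, hf, hfg, hg⟩ := SqfIdeal.exists_exact_subquotients hJI hle
    rw [← not_lt, ← not_lt, not_iff_not, SqfIdeal.depth, SqfIdeal.depth,
      SqfIdeal.lt_depthAt_iff, SqfIdeal.lt_depthAt_iff]
    exact ⟨fun h => h.left hf hfg hg hC, fun h => h.middle hf hfg hg hC⟩
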